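/- For $I\subseteq\mathbb{R}$ and integers $n,m\ge 0$, let $\mathbb{S}_n^m(I)$ be the set of real symmetric $n\times n$ matrices with all entries in $I$ and rank at most $m$, and let $\mathbb{P}_n^m(I)\subseteq\mathbb{S}_n^m(I)$ be the subset of positive semidefinite matrices; write $\mathbb{S}_n^m=\mathbb{S}_n^m(\mathbb{R})$ and $\mathbb{P}_n^m=\mathbb{P}_n^m(\mathbb{R})$. For $f:I\to\mathbb{R}$ and a matrix $A=(a_{ij})$ with entries in $I$, put $f[A]=(f(a_{ij}))$. **Theorem.** Fix $0<R\le\infty$ and integers $n,l,k$ with $2<l<k<\min(2l,n-1)$. Let $I=[0,R)$ or $I=(-R,R)$, and let $f:I\to\mathbb{R}$ be continuous. The following are equivalent: 1. $f[A]\in\mathbb{S}_n^k$ for every $A\in\mathbb{S}_n^l(I)$; 2. $f[A]\in\mathbb{S}_n^k$ for every $A\in\mathbb{P}_n^l(I)$; 3. there exists $c_1\in\mathbb{R}$ such that $f(x)=f(0)+c_1x$ for all $x\in I$. Moreover, $f[A]\in\mathbb{P}_n^k$ for every $A\in\mathbb{P}_n^l(I)$ if and only if $f(0)\ge 0$ and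 there exists $c_1\ge 0$ such that $f(x)=f(0)+c_1x$ for all $x\in I$. If $I=[0,R)$ and $k\le n-3$, this last equivalence holds for every function $f:I\to\mathbb{R}$, without assuming continuity. -/

import Mathlib

namespace RankEntrywise

/-- The interval `[0, R)`, where `R` may be `∞`. -/
def halfInterval (R : EReal) : Set ℝ := {x | 0 ≤ x ∧ (x : EReal) < R}

/-- The interval `(-R, R)`, where `R` may be `∞`. -/
def symmInterval (R : EReal) : Set ℝ := {x | -R < (x : EReal) ∧ (x : EReal) < R}

/-- The real symmetric `n × n` matrices with entries in `I` and rank at most `k`. -/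
def SymmRankLE (n k : ℕ) (I : Set ℝ) : Set (Matrix (Fin n) (Fin n) ℝ) :=
  {A | A.IsSymm ∧ (∀ i j, A i j ∈ I) ∧ A.rank ≤ k}

/-- The real symmetric positive semidefinite `n × n` matrices with entries in `I` and rank at
most `k`. -/
def PSDRankLE (n k : ℕ) (I : Set ℝ) : Set (Matrix (Fin n) (Fin n) ℝ) :=
  {A | A.PosSemidef ∧ (∀ i j, A i j ∈ I) ∧ A.rank ≤ k}

/-- The matrix `f[A]`, obtained by applying `f` to every entry of `A`. -/
def entrywise {n : ℕ} (f : ℝ → ℝ) (A : Matrix (Fin n) (Fin n) ℝ) : Matrix (Fin n) (Fin n) ℝ :=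
  Matrix.of fun i j => f (A i j)

end RankEntrywise

namespace RankEntrywise

open Filter Topology
open scoped Matrix

/-- If all principal minors of orders `k + 1` and `k + 2` of a symmetric kernel vanish, then the
kernel has rank at most `k`: any family of more than `k` rows satisfies a linear relation. -/
theorem exists_row_relation {X : Type*} (K : X → X → ℝ) (hK : ∀ x y, K x y = K y x) (k : ℕ)
    (hdet : ∀ m, k < m → m ≤ k + 2 → ∀ z : Fin m → X,
      (Matrix.of fun i j => K (z i) (z j)).det = 0)
    {ι : Type*} [Fintype ι] (hι : k < Fintype.card ι) (x : ι → X) :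
    ∃ c : ι → ℝ, c ≠ 0 ∧ ∀ y, ∑ a, c a * K (x a) y = 0 := by
  classical
  let P : ℕ → Prop := fun s => ∃ z : Fin s → X, (Matrix.of fun i j => K (z i) (z j)).det ≠ 0
  have hP0 : P 0 := ⟨Fin.elim0, by simp⟩
  set s := Nat.findGreatest P k with hs
  have hsk : s ≤ k := Nat.findGreatest_le k
  obtain ⟨z, hz⟩ : P s := Nat.findGreatest_spec (Nat.zero_le k) hP0
  have hmax : ∀ m, s < m → m ≤ k + 2 → ∀ z : Fin m → X,
      (Matrix.of fun i j => K (z i) (z j)).det = 0 := by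
    intro m hm hmk z'
    by_cases h : m ≤ k
    · by_contra hne
      exact Nat.findGreatest_is_greatest hm h ⟨z', hne⟩
    · exact hdet m (by omega) hmk z'
  set M : Matrix (Fin s) (Fin s) ℝ := Matrix.of fun i j => K (z i) (z j) with hM
  have hMu : IsUnit M.det := isUnit_iff_ne_zero.2 hz
  have : Invertible M := Matrix.invertibleOfIsUnitDet M hMu
  let v : X → Fin s → ℝ := fun x i => K (z i) x
  let S : X → X → ℝ := fun x y => K x y - v x ⬝ᵥ (⅟M *ᵥ v y)
  have hMs : (⅟M)ᵀ = ⅟M := by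
    rw [Matrix.invOf_eq_nonsing_inv, Matrix.transpose_nonsing_inv]
    congr 1
    ext i j
    exact hK _ _
  have hSs : ∀ x y, S x y = S y x := by
    intro x y
    have : v x ⬝ᵥ (⅟M *ᵥ v y) = v y ⬝ᵥ (⅟M *ᵥ v x) := by
      rw [Matrix.dotProduct_mulVec, ← Matrix.mulVec_transpose, hMs, dotProduct_comm]
    simp only [S, this, hK x y]
  have hSdet : ∀ m, 0 < m → m ≤ 2 → ∀ w : Fin m → X,
      (Matrix.of fun i j => S (w i) (w j)).det = 0 := by
    intro m hm hm2 w
    have h1 := hmax (s + m) (by omega) (by omega) (Fin.append z w)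
    rw [← Matrix.det_submatrix_equiv_self (finSumFinEquiv (m := s) (n := m))] at h1
    have h2 : (Matrix.of fun i j => K (Fin.append z w i) (Fin.append z w j)).submatrix
        (finSumFinEquiv (m := s) (n := m)) finSumFinEquiv =
        Matrix.fromBlocks M (Matrix.of fun i j => v (w j) i) (Matrix.of fun i j => v (w i) j)
          (Matrix.of fun i j => K (w i) (w j)) := by
      ext i j
      rcases i with i | i <;> rcases j with j | j <;> simp [hM, v, hK]
    rw [h2, Matrix.det_fromBlocks₁₁] at h1
    have h3 := (mul_eq_zero.1 h1).resolve_left hz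
    rw [← h3]
    congr 1
    ext i j
    simp only [Matrix.of_apply, Matrix.sub_apply, S, Matrix.mul_assoc]
    rfl
  have hSd : ∀ x, S x x = 0 := by
    intro x
    simpa using hSdet 1 one_pos one_le_two (fun _ => x)
  have hS : ∀ x y, S x y = 0 := by
    intro x y
    have h := hSdet 2 two_pos le_rfl ![x, y]
    rw [Matrix.det_fin_two] at h
    simp only [Matrix.of_apply, Matrix.cons_val_zero, Matrix.cons_val_one, hSd, hSs y x] at h
    nlinarith
  let T : (ι → ℝ) →ₗ[ℝ] (Fin s → ℝ) := Fintype.linearCombination ℝ (fun a => v (x a))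
  have hT : LinearMap.ker T ≠ ⊥ := LinearMap.ker_ne_bot_of_finrank_lt (by simp; omega)
  obtain ⟨c, hc, hc0⟩ := (Submodule.ne_bot_iff _).1 hT
  refine ⟨c, hc0, fun y => ?_⟩
  have hc' : ∑ a, c a • v (x a) = 0 := by
    simpa [T, Fintype.linearCombination_apply] using hc
  have h4 : ∀ a, K (x a) y = v (x a) ⬝ᵥ (⅟M *ᵥ v y) := fun a => sub_eq_zero.1 (hS (x a) y)
  simp only [h4]
  rw [← zero_dotProduct (⅟M *ᵥ v y), ← hc', sum_dotProduct]
  simp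

/-- A function with vanishing second derivative on an interval is affine there. -/
theorem eq_segment_of_deriv_deriv_zero {F F' : ℝ → ℝ} {α β : ℝ} (hαβ : α ≤ β)
    (hF : ∀ t, HasDerivAt F (F' t) t) (hF' : ∀ t ∈ Set.Icc α β, HasDerivAt F' 0 t)
    {θ : ℝ} (h0 : 0 ≤ θ) (h1 : θ ≤ 1) :
    F ((1 - θ) * α + θ * β) = (1 - θ) * F α + θ * F β := by
  have hconst : ∀ t ∈ Set.Icc α β, F' t = F' α :=
    constant_of_has_deriv_right_zero (fun t ht => (hF' t ht).continuousAt.continuousWithinAt)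
      (fun t ht => (hF' t ⟨ht.1, ht.2.le⟩).hasDerivWithinAt)
  have hlin : ∀ t ∈ Set.Icc α β, F t - F' α * t = F α - F' α * α := by
    refine constant_of_has_deriv_right_zero
      (f := fun t => F t - F' α * t) (fun t ht => ?_) (fun t ht => ?_)
    · exact ((hF t).sub ((hasDerivAt_id t).const_mul (F' α))).continuousAt.continuousWithinAt
    · have := (hF t).fun_sub ((hasDerivAt_id' t).const_mul (F' α))
      rw [hconst t ⟨ht.1, ht.2.le⟩, mul_one, sub_self] at this
      exact this.hasDerivWithinAt
  have e1 := hlin ((1 - θ) * α + θ * β) ⟨by nlinarith, by nlinarith⟩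
  have e2 := hlin β ⟨hαβ, le_rfl⟩
  linear_combination e1 - θ * e2

/-- A continuous solution of `∑ c a * f (t + ε * s a) = 0` for small `ε` is affine, unless the
second moment of the weights vanishes. -/
theorem eq_segment_of_eventually_sum_eq_zero {ι : Type*} [Fintype ι] {f : ℝ → ℝ}
    (hf : Continuous f) {c s : ι → ℝ} (hs : ∑ a, c a * s a ^ 2 ≠ 0) {α β : ℝ} (hαβ : α ≤ β)
    (h : ∀ᶠ ε in 𝓝 (0 : ℝ), ∀ t ∈ Set.Icc α β, ∑ a, c a * f (t + ε * s a) = 0)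
    {θ : ℝ} (h0 : 0 ≤ θ) (h1 : θ ≤ 1) :
    f ((1 - θ) * α + θ * β) = (1 - θ) * f α + θ * f β := by
  obtain ⟨G, hG⟩ : ∃ G : ℝ → ℝ, ∀ t, HasDerivAt G (f t) t :=
    ⟨fun x => ∫ t in (0 : ℝ)..x, f t, fun t => hf.integral_hasStrictDerivAt 0 t |>.hasDerivAt⟩
  have hGc : Continuous G := continuous_iff_continuousAt.2 fun t => (hG t).continuousAt
  obtain ⟨F, hF⟩ : ∃ F : ℝ → ℝ, ∀ t, HasDerivAt F (G t) t :=
    ⟨fun x => ∫ t in (0 : ℝ)..x, G t, fun t => hGc.integral_hasStrictDerivAt 0 t |>.hasDerivAt⟩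
  set γ := (1 - θ) * α + θ * β with hγ
  let D : (ℝ → ℝ) → ℝ → ℝ := fun g u => g (γ + u) - (1 - θ) * g (α + u) - θ * g (β + u)
  have hD : ∀ g g' : ℝ → ℝ, (∀ t, HasDerivAt g (g' t) t) → ∀ u, HasDerivAt (D g) (D g' u) u := by
    intro g g' hg u
    exact (((hg _).comp_const_add γ u).sub (((hg _).comp_const_add α u).const_mul _)).sub
      (((hg _).comp_const_add β u).const_mul _)
  have hS : ∀ (w : ι → ℝ) (g g' : ℝ → ℝ), (∀ t, HasDerivAt g (g' t) t) → ∀ ε,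
      HasDerivAt (fun ε => ∑ a, w a * D g (ε * s a)) (∑ a, w a * s a * D g' (ε * s a)) ε := by
    intro w g g' hg ε
    refine HasDerivAt.fun_sum fun a _ => ?_
    have h2 : HasDerivAt (fun ε : ℝ => ε * s a) (s a) ε := by
      simpa using (hasDerivAt_id ε).mul_const (s a)
    have h3 := ((hD g g' hg (ε * s a)).comp ε h2).const_mul (w a)
    rw [mul_assoc, mul_comm (s a)]
    exact h3
  have hψ : (fun ε => ∑ a, c a * D F (ε * s a)) =ᶠ[𝓝 0] fun _ => 0 := by
    filter_upwards [h] with ε hε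
    have hsum : ∀ (g g' : ℝ → ℝ), (∀ t, HasDerivAt g (g' t) t) → ∀ t,
        HasDerivAt (fun t => ∑ a, c a * g (t + ε * s a)) (∑ a, c a * g' (t + ε * s a)) t :=
      fun g g' hg t => HasDerivAt.fun_sum fun a _ =>
        ((hg _).comp_add_const t (ε * s a)).const_mul (c a)
    have h4 := eq_segment_of_deriv_deriv_zero hαβ (hsum F G hF)
      (fun t ht => by simpa [hε t ht] using hsum G f hG t) h0 h1
    simp only [D]
    rw [Finset.mul_sum, Finset.mul_sum] at h4
    rw [← sub_eq_zero] at h4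
    rw [← h4, ← Finset.sum_add_distrib, ← Finset.sum_sub_distrib]
    refine Finset.sum_congr rfl fun a _ => ?_
    ring
  have hψ' : (fun ε => ∑ a, c a * s a * D G (ε * s a)) =ᶠ[𝓝 0] fun _ => 0 := by
    filter_upwards [hψ.eventuallyEq_nhds] with ε hε
    have h5 := (hS c F G hF ε).deriv
    rw [hε.deriv_eq] at h5
    simpa using h5.symm
  have h6 := (hS (fun a => c a * s a) G f hG 0).deriv
  rw [hψ'.deriv_eq] at h6
  have h7 : (∑ a, c a * s a ^ 2) * D f 0 = 0 := by
    rw [Finset.sum_mul]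
    simp only [zero_mul, deriv_const] at h6
    refine Eq.trans ?_ h6.symm
    exact Finset.sum_congr rfl fun a _ => by ring
  have h8 := (mul_eq_zero.1 h7).resolve_left hs
  simp only [D, add_zero] at h8
  linarith

/-- The `2 * l` vectors `2 eᵢ` and `eᵢ + eᵢ₊₁` (indices modulo `l`). -/
def cycleVec (l : ℕ) [NeZero l] : Fin l ⊕ Fin l → Fin l → ℝ
  | Sum.inl i => Pi.single i 2
  | Sum.inr i => Pi.single i 1 + Pi.single (i + 1) 1

theorem sum_cycleVec {l : ℕ} [NeZero l] (a : Fin l ⊕ Fin l) : ∑ p, cycleVec l a p = 2 := by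
  rcases a with i | i
  · simp [cycleVec]
  · simp [cycleVec, Finset.sum_add_distrib]
    norm_num

theorem cycleVec_nonneg {l : ℕ} [NeZero l] (a : Fin l ⊕ Fin l) (p : Fin l) :
    0 ≤ cycleVec l a p := by
  rcases a with i | i <;> simp only [cycleVec, Pi.add_apply, Pi.single_apply] <;> positivity

/-- The rank one quadratic forms of the vectors `2 eᵢ` and `eᵢ + eᵢ₊₁` are linearly
independent. -/
theorem exists_sum_cycleVec_sq_ne_zero {l : ℕ} [NeZero l] (hl : 2 < l) {c : Fin l ⊕ Fin l → ℝ}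
    (hc : c ≠ 0) : ∃ w : Fin l → ℝ, ∑ a, c a * (cycleVec l a ⬝ᵥ w) ^ 2 ≠ 0 := by
  by_contra! hB
  have hpol : ∀ p q, ∑ a, c a * (cycleVec l a p * cycleVec l a q) = 0 := by
    intro p q
    have h1 := hB (Pi.single p 1 + Pi.single q 1)
    have h2 := hB (Pi.single p 1)
    have h3 := hB (Pi.single q 1)
    simp only [dotProduct_add, dotProduct_single_one] at h1 h2 h3
    have h4 : 2 * ∑ a, c a * (cycleVec l a p * cycleVec l a q) = 0 := by
      have h5 : ∑ a, (c a * (cycleVec l a p + cycleVec l a q) ^ 2 - c a * cycleVec l a p ^ 2 -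
          c a * cycleVec l a q ^ 2) = 0 := by
        rw [Finset.sum_sub_distrib, Finset.sum_sub_distrib, h1, h2, h3]; norm_num
      rw [← h5, Finset.mul_sum]
      exact Finset.sum_congr rfl fun a _ => by ring
    linarith
  have hone : (1 : Fin l) ≠ 0 := by
    intro h
    have := congrArg Fin.val h
    rw [Fin.val_one', Fin.val_zero, Nat.mod_eq_of_lt (by omega)] at this
    omega
  have htwo : (1 + 1 : Fin l) ≠ 0 := by
    intro h
    have := congrArg Fin.val h
    rw [Fin.val_add, Fin.val_one', Fin.val_zero, Nat.mod_eq_of_lt (a := 1) (by omega),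
      Nat.mod_eq_of_lt (by omega)] at this
    omega
  have hne : ∀ p : Fin l, p ≠ p + 1 := fun p h => hone (by simpa using h.symm)
  have hne2 : ∀ p : Fin l, p + 1 + 1 ≠ p := fun p h => htwo (by simpa [add_assoc] using h)
  have hr : ∀ p, c (Sum.inr p) = 0 := by
    intro p
    have h := hpol p (p + 1)
    rw [Fintype.sum_sum_type, Finset.sum_eq_zero, zero_add, Finset.sum_eq_single p] at h
    · simpa [cycleVec, Pi.single_apply, hne p, (hne p).symm] using h
    · intro i _ hi
      simp only [cycleVec, Pi.add_apply, Pi.single_apply, add_left_inj]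
      by_cases h1 : p + 1 = i
      · subst h1
        simp [hne p, (hne2 p).symm]
      · simp [hi.symm, h1]
    · simp
    · intro i _
      simp only [cycleVec, Pi.single_apply]
      by_cases h1 : p = i
      · subst h1
        simp [(hne p).symm]
      · simp [h1]
  apply hc
  ext a
  rcases a with p | p
  · have h := hpol p p
    simpa [Fintype.sum_sum_type, hr, cycleVec, Pi.single_apply] using h
  · exact hr p

theorem gram_mem_PSDRankLE {n l : ℕ} {I : Set ℝ} (z : Fin n → Fin l → ℝ)
    (hz : ∀ i j, z i ⬝ᵥ z j ∈ I) : Matrix.of (fun i j => z i ⬝ᵥ z j) ∈ PSDRankLE n l I := by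
  have h : Matrix.of (fun i j => z i ⬝ᵥ z j) = Matrix.of z * (Matrix.of z)ᴴ := by
    ext i j
    simp [Matrix.mul_apply, dotProduct]
  refine ⟨?_, hz, ?_⟩
  · rw [h]
    exact Matrix.posSemidef_self_mul_conjTranspose _
  · rw [h]
    refine (Matrix.rank_mul_le_left _ _).trans ?_
    simpa using (Matrix.of z).rank_le_card_width

/-- The function applied to a Gram matrix of order `m ≤ n` is a principal submatrix of the
function applied to a Gram matrix of order `n`. -/
theorem exists_entrywise_submatrix {m n l : ℕ} (hmn : m ≤ n) {I : Set ℝ} (h0 : (0 : ℝ) ∈ I)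
    (f : ℝ → ℝ) (z : Fin m → Fin l → ℝ) (hz : ∀ i j, z i ⬝ᵥ z j ∈ I) :
    ∃ A ∈ PSDRankLE n l I, (Matrix.of fun i j => f (z i ⬝ᵥ z j)) =
      (entrywise f A).submatrix (Fin.castLE hmn) (Fin.castLE hmn) := by
  refine ⟨_, gram_mem_PSDRankLE
    (fun i : Fin n => if h : (i : ℕ) < m then z ⟨i, h⟩ else 0) fun i j => ?_, ?_⟩
  · by_cases hi : (i : ℕ) < m <;> by_cases hj : (j : ℕ) < m <;> simp [hi, hj, h0, hz]
  · ext i j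
    simp [entrywise]

theorem det_gram_eq_zero {n l k m : ℕ} {I : Set ℝ} (h0 : (0 : ℝ) ∈ I) {f : ℝ → ℝ}
    (hf : ∀ A ∈ PSDRankLE n l I, (entrywise f A).rank ≤ k) (hkm : k < m) (hmn : m ≤ n)
    (z : Fin m → Fin l → ℝ) (hz : ∀ i j, z i ⬝ᵥ z j ∈ I) :
    (Matrix.of fun i j => f (z i ⬝ᵥ z j)).det = 0 := by
  obtain ⟨A, hA, h⟩ := exists_entrywise_submatrix hmn h0 f z hz
  by_contra hdet
  have h1 := Matrix.rank_of_isUnit _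
    ((Matrix.isUnit_iff_isUnit_det _).2 (isUnit_iff_ne_zero.2 hdet))
  rw [Fintype.card_fin, h] at h1
  have h2 := (Matrix.rank_submatrix_le (entrywise f A) (Fin.castLE hmn) (Fin.castLE hmn)).trans
    (hf A hA)
  omega

/-- A continuous function `f` such that `f[A]` has rank at most `k < 2 * l` for all positive
semidefinite `A` of rank at most `l` is affine on the segments on which the inner products of the
vectors in a neighbourhood of the diagonal are available. -/
theorem eq_segment_of_rank_le {n l k : ℕ} (hl : 2 < l) (hk : k < 2 * l) (hn : k + 2 ≤ n)
    {I : Set ℝ} {f : ℝ → ℝ} (hcont : ContinuousOn f I)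
    (hf : ∀ A ∈ PSDRankLE n l I, (entrywise f A).rank ≤ k) {C : Set (Fin l → ℝ)} {ρ : ℝ}
    (hCI : ∀ x ∈ C, ∀ y ∈ C, x ⬝ᵥ x < ρ → y ⬝ᵥ y < ρ → x ⬝ᵥ y ∈ I)
    (hC0 : ∀ x : Fin l → ℝ, (∀ p, 0 ≤ x p) → x ∈ C) {α β α' β' : ℝ} (hαβ : α ≤ β)
    (hα : |α| < ρ) (hβ : |β| < ρ) (hα' : α' < α) (hβ' : β < β') (hI : Set.Icc α' β' ⊆ I)
    (hC : ∀ t ∈ Set.Icc α β, ∀ r > 0, C ∈ 𝓝 (fun _ => r * t))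
    {θ : ℝ} (h0 : 0 ≤ θ) (h1 : θ ≤ 1) :
    f ((1 - θ) * α + θ * β) = (1 - θ) * f α + θ * f β := by
  have : NeZero l := ⟨by omega⟩
  have hl0 : (0 : ℝ) < l := by exact_mod_cast (by omega : 0 < l)
  obtain ⟨μ, hμ, hμρ⟩ := exists_between (max_lt hα hβ)
  have hμ0 : 0 < μ := (abs_nonneg α).trans_lt ((le_max_left _ _).trans_lt hμ)
  have hρ0 : 0 < ρ := hμ0.trans hμρ
  set s := √(μ / l) with hs
  have hs0 : 0 < s := Real.sqrt_pos.2 (by positivity)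
  have hs2 : s * s * l = μ := by
    rw [hs, Real.mul_self_sqrt (by positivity)]
    field_simp
  let x : ℝ → Fin l ⊕ Fin l → Fin l → ℝ := fun δ a p => s * (1 + δ * cycleVec l a p)
  obtain ⟨δ, hδ0, hδ⟩ : ∃ δ > 0, ∀ a, x δ a ⬝ᵥ x δ a < ρ := by
    have h : ∀ᶠ δ in 𝓝[>] (0 : ℝ), ∀ a, x δ a ⬝ᵥ x δ a < ρ := by
      refine nhdsWithin_le_nhds (eventually_all.2 fun a => ?_)
      have hc : Continuous fun δ => x δ a ⬝ᵥ x δ a := by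
        simp only [x, dotProduct]
        fun_prop
      refine hc.continuousAt.eventually_lt continuousAt_const ?_
      simp only [x, dotProduct, zero_mul, add_zero, mul_one, Finset.sum_const, Finset.card_univ,
        Fintype.card_fin, nsmul_eq_mul]
      linarith
    obtain ⟨δ, hδ, hpos⟩ := (h.and self_mem_nhdsWithin).exists
    exact ⟨δ, hpos, hδ⟩
  have hxC : ∀ a, x δ a ∈ C := fun a => hC0 _ fun p => by
    have := cycleVec_nonneg a p
    simp only [x]
    positivity
  let X : Set (Fin l → ℝ) := {y | y ∈ C ∧ y ⬝ᵥ y < ρ}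
  have hX0 : (0 : Fin l → ℝ) ∈ X := ⟨hC0 0 fun _ => le_rfl, by simpa using hρ0⟩
  have h0I : (0 : ℝ) ∈ I := by simpa using hCI 0 hX0.1 0 hX0.1 hX0.2 hX0.2
  obtain ⟨c, hc0, hc⟩ := exists_row_relation (X := X) (fun x y => f (x.1 ⬝ᵥ y.1))
    (fun x y => by rw [dotProduct_comm]) k
    (fun m hkm hmk z => det_gram_eq_zero h0I hf hkm (hmk.trans hn) (fun i => (z i).1)
      fun i j => hCI _ (z i).2.1 _ (z j).2.1 (z i).2.2 (z j).2.2)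
    (ι := Fin l ⊕ Fin l) (by simp; omega) fun a => ⟨x δ a, hxC a, hδ a⟩
  obtain ⟨w, hw⟩ := exists_sum_cycleVec_sq_ne_zero hl hc0
  set r := (s * (l + 2 * δ))⁻¹ with hr
  have hr0 : 0 < r := by positivity
  have hrs : r * (s * (l + 2 * δ)) = 1 := inv_mul_cancel₀ (by positivity)
  -- the constant shift makes the pairing with `x δ a` equal to `s * δ * (cycleVec l a ⬝ᵥ w)`
  let y : ℝ → ℝ → Fin l → ℝ := fun ε t p => r * t + ε * (w p - r * s * ∑ q, w q)
  have hxy : ∀ a ε t, x δ a ⬝ᵥ y ε t = t + ε * (s * δ * (cycleVec l a ⬝ᵥ w)) := by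
    intro a ε t
    have e1 : x δ a ⬝ᵥ y ε t = ∑ p, (s * (r * t - ε * (r * s * ∑ q, w q)) +
        s * δ * (r * t - ε * (r * s * ∑ q, w q)) * cycleVec l a p + s * ε * w p +
        ε * (s * δ) * (cycleVec l a p * w p)) := by
      simp only [dotProduct, x, y]
      exact Finset.sum_congr rfl fun p _ => by ring
    rw [e1]
    simp only [Finset.sum_add_distrib, ← Finset.mul_sum, sum_cycleVec, Finset.sum_const,
      Finset.card_univ, Fintype.card_fin, nsmul_eq_mul, dotProduct]
    linear_combination (t - ε * s * ∑ q, w q) * hrs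
  have hyX : ∀ᶠ ε in 𝓝 (0 : ℝ), ∀ t ∈ Set.Icc α β, y ε t ∈ X := by
    refine isCompact_Icc.eventually_forall_of_forall_eventually fun t ht => ?_
    have hyc : Continuous fun z : ℝ × ℝ => y z.1 z.2 := by
      simp only [y]
      fun_prop
    have hy0 : y 0 t = fun _ => r * t := by
      ext p
      simp [y]
    refine Filter.Eventually.and ?_ ?_
    · have hCn := hC t ht r hr0
      rw [← hy0] at hCn
      exact (hyc.continuousAt (x := ((0 : ℝ), t))).preimage_mem_nhds hCn
    · have hd : Continuous fun z : ℝ × ℝ => y z.1 z.2 ⬝ᵥ y z.1 z.2 := by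
        simp only [y, dotProduct]
        fun_prop
      refine (hd.continuousAt (x := ((0 : ℝ), t))).eventually_lt continuousAt_const ?_
      simp only [hy0, dotProduct, Finset.sum_const, Finset.card_univ, Fintype.card_fin,
        nsmul_eq_mul]
      have ht' : |t| < μ := (abs_le_max_abs_abs ht.1 ht.2).trans_lt hμ
      have ht2 : t * t < μ * μ := by
        rw [← abs_mul_abs_self t]
        exact mul_self_lt_mul_self (abs_nonneg t) ht'
      have hr1 : r * (s * l) ≤ 1 := by
        rw [← hrs]
        gcongr
        linarith
      have hr2 : (r * (s * l)) * (r * (s * l)) ≤ 1 * 1 := by gcongr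
      have hr3 : l * (r * r) * μ ≤ 1 := by
        rw [← hs2]
        linarith
      have : l * (r * t * (r * t)) * μ ≤ t * t := by nlinarith [mul_self_nonneg t]
      by_contra! hcon
      nlinarith [mul_le_mul_of_nonneg_right hcon hμ0.le]
  let g : ℝ → ℝ := fun t => f (max α' (min t β'))
  have hαβ' : α' ≤ β' := by linarith
  have hg : Continuous g := by
    refine hcont.comp_continuous (by fun_prop) fun t => hI ⟨le_max_left _ _, ?_⟩
    exact max_le hαβ' (min_le_right _ _)
  have hgf : ∀ t ∈ Set.Icc α' β', g t = f t := by
    intro t ht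
    simp only [g, min_eq_left ht.2, max_eq_right ht.1]
  have hmem : ∀ a, ∀ᶠ ε in 𝓝 (0 : ℝ), ∀ t ∈ Set.Icc α β,
      t + ε * (s * δ * (cycleVec l a ⬝ᵥ w)) ∈ Set.Icc α' β' := by
    intro a
    refine isCompact_Icc.eventually_forall_of_forall_eventually fun t ht => ?_
    have hcc : Continuous fun z : ℝ × ℝ => z.2 + z.1 * (s * δ * (cycleVec l a ⬝ᵥ w)) := by
      fun_prop
    refine (hcc.continuousAt (x := ((0 : ℝ), t))).preimage_mem_nhds (Icc_mem_nhds ?_ ?_)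
    · simp only [zero_mul, add_zero]
      linarith [ht.1]
    · simp only [zero_mul, add_zero]
      linarith [ht.2]
  have key := eq_segment_of_eventually_sum_eq_zero hg (c := c)
    (s := fun a => s * δ * (cycleVec l a ⬝ᵥ w)) ?_ hαβ ?_ h0 h1
  · have hmid : (1 - θ) * α + θ * β ∈ Set.Icc α' β' := ⟨by nlinarith, by nlinarith⟩
    rwa [hgf _ hmid, hgf α ⟨by linarith, by linarith⟩, hgf β ⟨by linarith, by linarith⟩] at key
  · have e2 : ∑ a, c a * (s * δ * (cycleVec l a ⬝ᵥ w)) ^ 2 =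
        (s * δ) ^ 2 * ∑ a, c a * (cycleVec l a ⬝ᵥ w) ^ 2 := by
      rw [Finset.mul_sum]
      exact Finset.sum_congr rfl fun a _ => by ring
    rw [e2]
    exact mul_ne_zero (by positivity) hw
  · filter_upwards [hyX, eventually_all.2 hmem] with ε hε hm t ht
    rw [← hc ⟨y ε t, hε t ht⟩]
    exact Finset.sum_congr rfl fun a _ => by rw [hgf _ (hm a t ht), hxy]

theorem exists_affine_of_segment {I : Set ℝ} {f : ℝ → ℝ} (h0 : (0 : ℝ) ∈ I) {r : ℝ} (hr : 0 < r)
    (hrI : r ∈ I) (h : ∀ α ∈ I, ∀ β ∈ I, α ≤ β → ∀ θ : ℝ, 0 ≤ θ → θ ≤ 1 →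
      f ((1 - θ) * α + θ * β) = (1 - θ) * f α + θ * f β) :
    ∃ c₁ : ℝ, ∀ x ∈ I, f x = f 0 + c₁ * x := by
  refine ⟨(f r - f 0) / r, fun x hx => ?_⟩
  rcases lt_or_ge x 0 with hx0 | hx0
  · have hd : r - x ≠ 0 := by linarith
    have h1 := h x hx r hrI (by linarith) (-x / (r - x)) (div_nonneg (by linarith) (by linarith))
      ((div_le_one (by linarith)).2 (by linarith))
    have e : (1 - -x / (r - x)) * x + -x / (r - x) * r = 0 := by
      field_simp
      ring
    rw [e] at h1
    field_simp at h1 ⊢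
    linarith
  · rcases le_or_gt x r with hxr | hxr
    · have h1 := h 0 h0 r hrI hr.le (x / r) (by positivity) ((div_le_one hr).2 hxr)
      have e : (1 - x / r) * 0 + x / r * r = x := by
        field_simp
        ring
      rw [e] at h1
      rw [h1]
      ring
    · have hx' : 0 < x := hr.trans hxr
      have h1 := h 0 h0 x hx hx0 (r / x) (by positivity) ((div_le_one hx').2 hxr.le)
      have e : (1 - r / x) * 0 + r / x * x = r := by
        field_simp
        ring
      rw [e] at h1
      field_simp at h1 ⊢
      linarith

theorem two_mul_abs_dotProduct_le {l : ℕ} (x y : Fin l → ℝ) :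
    2 * |x ⬝ᵥ y| ≤ x ⬝ᵥ x + y ⬝ᵥ y := by
  have h1 : 0 ≤ (x + y) ⬝ᵥ (x + y) := Finset.sum_nonneg fun i _ => mul_self_nonneg _
  have h2 : 0 ≤ (x - y) ⬝ᵥ (x - y) := Finset.sum_nonneg fun i _ => mul_self_nonneg _
  simp only [add_dotProduct, dotProduct_add, sub_dotProduct, dotProduct_sub,
    dotProduct_comm y x] at h1 h2
  rcases abs_cases (x ⬝ᵥ y) with h | h <;> linarith

theorem coe_abs_lt_of_mem_symmInterval {R : EReal} {x : ℝ} (hx : x ∈ symmInterval R) :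
    ((|x| : ℝ) : EReal) < R := by
  rcases abs_cases x with h | h
  · rw [h.1]
    exact hx.2
  · rw [h.1, EReal.coe_neg]
    exact EReal.neg_lt_comm.1 hx.1

theorem mem_symmInterval_of_abs_lt {R : EReal} {x ρ : ℝ} (hx : |x| < ρ) (hρ : (ρ : EReal) < R) :
    x ∈ symmInterval R := by
  have h := abs_lt.1 hx
  refine ⟨EReal.neg_lt_comm.1 ?_, (EReal.coe_lt_coe_iff.2 h.2).trans hρ⟩
  rw [← EReal.coe_neg]
  exact (EReal.coe_lt_coe_iff.2 (by linarith)).trans hρ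

theorem zero_mem_halfInterval {R : EReal} (hR : 0 < R) : (0 : ℝ) ∈ halfInterval R :=
  ⟨le_rfl, by simpa using hR⟩

theorem mem_halfInterval_of_le {R : EReal} {x y : ℝ} (hx : 0 ≤ x) (hxy : x ≤ y)
    (hy : y ∈ halfInterval R) : x ∈ halfInterval R :=
  ⟨hx, (EReal.coe_le_coe_iff.2 hxy).trans_lt hy.2⟩

theorem halfInterval_subset_symmInterval {R : EReal} (hR : 0 < R) :
    halfInterval R ⊆ symmInterval R := by
  intro x hx
  refine ⟨?_, hx.2⟩
  have h : -R < 0 := by simpa using EReal.neg_lt_neg_iff.2 hR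
  exact h.trans_le (by exact_mod_cast hx.1)

theorem exists_pos_mem_halfInterval {R : EReal} (hR : 0 < R) : ∃ r ∈ halfInterval R, 0 < r := by
  obtain ⟨r, hr0, hr⟩ := EReal.lt_iff_exists_real_btwn.1 hR
  have : 0 < r := by exact_mod_cast hr0
  exact ⟨r, ⟨this.le, hr⟩, this⟩

variable {n l k : ℕ} {R : EReal} {f : ℝ → ℝ}

theorem eq_segment_symmInterval (hl : 2 < l) (hk : k < 2 * l) (hn : k + 2 ≤ n)
    (hcont : ContinuousOn f (symmInterval R))
    (hf : ∀ A ∈ PSDRankLE n l (symmInterval R), (entrywise f A).rank ≤ k)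
    {α β : ℝ} (hα : α ∈ symmInterval R) (hβ : β ∈ symmInterval R) (hαβ : α ≤ β)
    {θ : ℝ} (h0 : 0 ≤ θ) (h1 : θ ≤ 1) :
    f ((1 - θ) * α + θ * β) = (1 - θ) * f α + θ * f β := by
  have hmax : ((max |α| |β| : ℝ) : EReal) < R := by
    rcases max_choice |α| |β| with h | h <;> rw [h]
    exacts [coe_abs_lt_of_mem_symmInterval hα, coe_abs_lt_of_mem_symmInterval hβ]
  obtain ⟨ρ, hρ, hρR⟩ := EReal.lt_iff_exists_real_btwn.1 hmax
  obtain ⟨hαρ, hβρ⟩ := max_lt_iff.1 (EReal.coe_lt_coe_iff.1 hρ)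
  obtain ⟨β', hβ1, hβ2⟩ := exists_between (abs_lt.1 hβρ).2
  obtain ⟨α', hα1, hα2⟩ := exists_between (abs_lt.1 hαρ).1
  refine eq_segment_of_rank_le hl hk hn hcont hf (C := Set.univ) (ρ := ρ) ?_
    (fun _ _ => trivial) hαβ hαρ hβρ hα2 hβ1 ?_ (fun _ _ _ _ => Filter.univ_mem) h0 h1
  · intro x _ y _ hx hy
    exact mem_symmInterval_of_abs_lt (by linarith [two_mul_abs_dotProduct_le x y]) hρR
  · intro t ht
    exact mem_symmInterval_of_abs_lt (abs_lt.2 ⟨by linarith [ht.1], by linarith [ht.2]⟩) hρR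

theorem eq_segment_halfInterval_of_pos (hl : 2 < l) (hk : k < 2 * l) (hn : k + 2 ≤ n)
    (hcont : ContinuousOn f (halfInterval R))
    (hf : ∀ A ∈ PSDRankLE n l (halfInterval R), (entrywise f A).rank ≤ k)
    {α β : ℝ} (hα : 0 < α) (hβ : β ∈ halfInterval R) (hαβ : α ≤ β)
    {θ : ℝ} (h0 : 0 ≤ θ) (h1 : θ ≤ 1) :
    f ((1 - θ) * α + θ * β) = (1 - θ) * f α + θ * f β := by
  obtain ⟨ρ, hρ, hρR⟩ := EReal.lt_iff_exists_real_btwn.1 hβ.2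
  have hβρ : β < ρ := EReal.coe_lt_coe_iff.1 hρ
  obtain ⟨β', hβ1, hβ2⟩ := exists_between hβρ
  refine eq_segment_of_rank_le hl hk hn hcont hf (C := {x | ∀ p, 0 ≤ x p}) (ρ := ρ) ?_
    (fun _ h => h) hαβ (by rw [abs_of_pos hα]; linarith) (by rwa [abs_of_nonneg hβ.1])
    (half_lt_self hα) hβ1 ?_ ?_ h0 h1
  · intro x hx y hy hxρ hyρ
    refine mem_halfInterval_of_le (y := ρ) (Finset.sum_nonneg fun i _ => mul_nonneg (hx i) (hy i))
      ?_ ⟨by linarith, hρR⟩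
    linarith [two_mul_abs_dotProduct_le x y, le_abs_self (x ⬝ᵥ y)]
  · intro t ht
    exact mem_halfInterval_of_le (y := ρ) (by linarith [ht.1]) (by linarith [ht.2])
      ⟨by linarith, hρR⟩
  · intro t ht r hr
    have hrt : 0 < r * t := mul_pos hr (hα.trans_le ht.1)
    refine (eventually_all (ι := Fin l)).2 fun p => ?_
    exact (continuous_apply p).continuousAt.eventually_const_le hrt

theorem eq_segment_halfInterval (hl : 2 < l) (hk : k < 2 * l) (hn : k + 2 ≤ n)
    (hcont : ContinuousOn f (halfInterval R))
    (hf : ∀ A ∈ PSDRankLE n l (halfInterval R), (entrywise f A).rank ≤ k)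
    {α β : ℝ} (hα : α ∈ halfInterval R) (hβ : β ∈ halfInterval R) (hαβ : α ≤ β)
    {θ : ℝ} (h0 : 0 ≤ θ) (h1 : θ ≤ 1) :
    f ((1 - θ) * α + θ * β) = (1 - θ) * f α + θ * f β := by
  rcases hα.1.lt_or_eq with h | rfl
  · exact eq_segment_halfInterval_of_pos hl hk hn hcont hf h hβ hαβ h0 h1
  rcases hβ.1.lt_or_eq with h | rfl
  swap
  · simp only [mul_zero, add_zero]
    ring
  have hev : ∀ᶠ t in 𝓝[>] (0 : ℝ), 0 < t ∧ t < β :=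
    Filter.Eventually.and self_mem_nhdsWithin (nhdsWithin_le_nhds (Iio_mem_nhds h))
  have hmem : ∀ θ : ℝ, 0 ≤ θ → θ ≤ 1 → ∀ᶠ t in 𝓝[>] (0 : ℝ),
      (1 - θ) * t + θ * β ∈ halfInterval R := by
    intro θ h0 h1
    filter_upwards [hev] with t ht
    exact mem_halfInterval_of_le (add_nonneg (mul_nonneg (by linarith) ht.1.le)
      (mul_nonneg h0 h.le)) (by nlinarith) hβ
  have htend : ∀ θ : ℝ, 0 ≤ θ → θ ≤ 1 → Tendsto (fun t : ℝ => f ((1 - θ) * t + θ * β)) (𝓝[>] 0)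
      (𝓝 (f ((1 - θ) * 0 + θ * β))) := by
    intro θ h0 h1
    have hm : (1 - θ) * 0 + θ * β ∈ halfInterval R :=
      mem_halfInterval_of_le (by nlinarith) (by nlinarith) hβ
    refine (hcont _ hm).tendsto.comp (tendsto_nhdsWithin_iff.2 ⟨?_, hmem θ h0 h1⟩)
    have : Continuous fun t : ℝ => (1 - θ) * t + θ * β := by fun_prop
    exact this.continuousAt.tendsto.mono_left nhdsWithin_le_nhds
  have hz := htend 0 le_rfl zero_le_one
  simp only [sub_zero, one_mul, zero_mul, add_zero] at hz
  refine tendsto_nhds_unique_of_eventuallyEq (htend θ h0 h1)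
    ((hz.const_mul (1 - θ)).add_const (θ * f β)) ?_
  filter_upwards [hev] with t ht
  exact eq_segment_halfInterval_of_pos hl hk hn hcont hf ht.1 hβ ht.2.le h0 h1

theorem exists_affine_of_rank_le (hR : 0 < R) (hl : 2 < l) (hk : k < 2 * l) (hn : k + 2 ≤ n)
    {I : Set ℝ} (hI : I = halfInterval R ∨ I = symmInterval R) (hcont : ContinuousOn f I)
    (hf : ∀ A ∈ PSDRankLE n l I, (entrywise f A).rank ≤ k) :
    ∃ c₁ : ℝ, ∀ x ∈ I, f x = f 0 + c₁ * x := by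
  obtain ⟨r, hrI, hr⟩ := exists_pos_mem_halfInterval hR
  have h0 := zero_mem_halfInterval hR
  rcases hI with rfl | rfl
  · exact exists_affine_of_segment h0 hr hrI fun α hα β hβ hαβ θ h0 h1 =>
      eq_segment_halfInterval hl hk hn hcont hf hα hβ hαβ h0 h1
  · have hsub := halfInterval_subset_symmInterval hR
    exact exists_affine_of_segment (hsub h0) hr (hsub hrI) fun α hα β hβ hαβ θ h0 h1 =>
      eq_segment_symmInterval hl hk hn hcont hf hα hβ hαβ h0 h1

/-- The quadratic form inequality for `f` applied to Gram matrices of planar vectors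
`(a i, b i)`. -/
theorem sum_planar_gram_nonneg {I : Set ℝ} (h0 : (0 : ℝ) ∈ I) (hl : 2 ≤ l)
    (hf : ∀ A ∈ PSDRankLE n l I, (entrywise f A).PosSemidef) {m : ℕ} (hmn : m ≤ n)
    (a b c : Fin m → ℝ) (hI : ∀ i j, a i * a j + b i * b j ∈ I) :
    0 ≤ ∑ i, ∑ j, c i * (f (a i * a j + b i * b j) * c j) := by
  let p₀ : Fin l := ⟨0, by omega⟩
  let p₁ : Fin l := ⟨1, by omega⟩
  have hp : p₀ ≠ p₁ := by simp [p₀, p₁]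
  let z : Fin m → Fin l → ℝ := fun i => Pi.single p₀ (a i) + Pi.single p₁ (b i)
  have hz : ∀ i j, z i ⬝ᵥ z j = a i * a j + b i * b j := by
    intro i j
    simp [z, hp, hp.symm]
  obtain ⟨A, hA, h⟩ := exists_entrywise_submatrix hmn h0 f z fun i j => by
    rw [hz]
    exact hI i j
  have hpsd := (hf A hA).submatrix (Fin.castLE hmn)
  rw [← h] at hpsd
  have := hpsd.dotProduct_mulVec_nonneg c
  simp only [hz] at this
  simpa [dotProduct, Matrix.mulVec, Finset.mul_sum] using this

theorem monotoneOn_of_posSemidef (hR : 0 < R) (hl : 2 ≤ l) (hn : 2 ≤ n)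
    (hf : ∀ A ∈ PSDRankLE n l (halfInterval R), (entrywise f A).PosSemidef) :
    MonotoneOn f (halfInterval R) := by
  intro y hy x hx hyx
  rcases hx.1.lt_or_eq with hx0 | rfl
  swap
  · rw [le_antisymm hyx hy.1]
  have hx2 : √x * √x = x := Real.mul_self_sqrt hx.1
  have hs0 : √x ≠ 0 := (Real.sqrt_pos.2 hx0).ne'
  have e1 : √x * (y / √x) = y := by field_simp
  have e2 : y / √x * (y / √x) = y ^ 2 / x := by
    rw [div_mul_div_comm, hx2, sq]
  have e3 : √(x - y ^ 2 / x) * √(x - y ^ 2 / x) = x - y ^ 2 / x := by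
    refine Real.mul_self_sqrt (sub_nonneg.2 ((div_le_iff₀ hx0).2 ?_))
    nlinarith [hy.1]
  have e4 : y / √x * (y / √x) + √(x - y ^ 2 / x) * √(x - y ^ 2 / x) = x := by
    rw [e2, e3]
    ring
  have h := sum_planar_gram_nonneg (zero_mem_halfInterval hR) hl hf hn ![√x, y / √x]
    ![0, √(x - y ^ 2 / x)] ![1, -1] (by
      simp only [Fin.forall_fin_two, Matrix.cons_val_zero, Matrix.cons_val_one, mul_zero,
        zero_mul, add_zero, hx2, e1, e4, mul_comm (y / √x) √x]
      exact ⟨⟨hx, hy⟩, hy, hx⟩)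
  simp only [Fin.sum_univ_two, Matrix.cons_val_zero, Matrix.cons_val_one, mul_zero,
        zero_mul, add_zero, hx2, e1, e4, mul_comm (y / √x) √x] at h
  linarith

theorem continuousAt_of_posSemidef (hR : 0 < R) (hl : 2 ≤ l) (hn : 2 ≤ n)
    (hf : ∀ A ∈ PSDRankLE n l (halfInterval R), (entrywise f A).PosSemidef)
    {g : ℝ → ℝ} (hg : Monotone g) {ρ x : ℝ} (hρR : (ρ : EReal) < R)
    (hgf : ∀ t ∈ Set.Icc 0 ρ, g t = f t) (hx0 : 0 < x) (hxρ : x < ρ) : ContinuousAt g x := by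
  rw [hg.continuousAt_iff_leftLim_eq_rightLim]
  refine le_antisymm (hg.leftLim_le_rightLim le_rfl) ?_
  let p : ℝ → ℝ := fun η => √x * (1 - η)
  let q : ℝ → ℝ := fun η => √x * (1 + 3 * η)
  have hx2 : √x * √x = x := Real.mul_self_sqrt hx0.le
  have hlim : ∀ u : ℝ → ℝ, Continuous u → u 0 = x → Tendsto u (𝓝[>] 0) (𝓝 x) :=
    fun u hu h0 => by
      rw [← h0]
      exact hu.continuousAt.tendsto.mono_left nhdsWithin_le_nhds
  have hη : ∀ᶠ η in 𝓝[>] (0 : ℝ), 0 < η ∧ η < 1 / 2 :=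
    Filter.Eventually.and self_mem_nhdsWithin (nhdsWithin_le_nhds (Iio_mem_nhds (by norm_num)))
  have hpp : ∀ η, p η * p η = x * ((1 - η) * (1 - η)) := fun η => by
    simp only [p]
    linear_combination ((1 - η) * (1 - η)) * hx2
  have hpq : ∀ η, p η * q η = x * ((1 - η) * (1 + 3 * η)) := fun η => by
    simp only [p, q]
    linear_combination ((1 - η) * (1 + 3 * η)) * hx2
  have hqq : ∀ η, q η * q η = x * ((1 + 3 * η) * (1 + 3 * η)) := fun η => by
    simp only [q]
    linear_combination ((1 + 3 * η) * (1 + 3 * η)) * hx2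
  have t1 : Tendsto (fun η => p η * p η) (𝓝[>] 0) (𝓝[<] x) := by
    refine tendsto_nhdsWithin_iff.2 ⟨hlim _ (by fun_prop) (by simp [p, hx2]), ?_⟩
    filter_upwards [hη] with η h
    rw [Set.mem_Iio, hpp]
    have : (1 - η) * (1 - η) < 1 := by nlinarith
    nlinarith
  have t2 : Tendsto (fun η => p η * q η) (𝓝[>] 0) (𝓝[>] x) := by
    refine tendsto_nhdsWithin_iff.2 ⟨hlim _ (by fun_prop) (by simp [p, q, hx2]), ?_⟩
    filter_upwards [hη] with η h
    rw [Set.mem_Ioi, hpq]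
    have : 1 < (1 - η) * (1 + 3 * η) := by nlinarith
    nlinarith
  have t3 : Tendsto (fun η => q η * q η) (𝓝[>] 0) (𝓝[>] x) := by
    refine tendsto_nhdsWithin_iff.2 ⟨hlim _ (by fun_prop) (by simp [q, hx2]), ?_⟩
    filter_upwards [hη] with η h
    rw [Set.mem_Ioi, hqq]
    have : 1 < (1 + 3 * η) * (1 + 3 * η) := by nlinarith
    nlinarith
  have l1 := (hg.tendsto_leftLim x).comp t1
  have l2 := (hg.tendsto_rightLim x).comp t2
  have l3 := (hg.tendsto_rightLim x).comp t3
  have key : 0 ≤ g.leftLim x - 2 * g.rightLim x + g.rightLim x := by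
    refine ge_of_tendsto ((l1.sub (l2.const_mul 2)).add l3) ?_
    have hle : ∀ {u : ℝ → ℝ} {s : Set ℝ}, Tendsto u (𝓝[>] 0) (𝓝[s] x) →
        ∀ᶠ η in 𝓝[>] (0 : ℝ), u η ∈ Set.Icc 0 ρ := fun hu =>
      (hu.mono_right nhdsWithin_le_nhds).eventually (Icc_mem_nhds hx0 hxρ)
    filter_upwards [hle t1, hle t2, hle t3] with η h1 h2 h3
    have hI : ∀ {t : ℝ}, t ∈ Set.Icc 0 ρ → t ∈ halfInterval R := fun ht =>
      mem_halfInterval_of_le ht.1 ht.2 ⟨by linarith, hρR⟩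
    have h := sum_planar_gram_nonneg (zero_mem_halfInterval hR) hl hf hn ![p η, q η] ![0, 0]
      ![1, -1] (by
        simp only [Fin.forall_fin_two, Matrix.cons_val_zero, Matrix.cons_val_one, mul_zero,
          add_zero, mul_comm (q η) (p η)]
        exact ⟨⟨hI h1, hI h2⟩, hI h2, hI h3⟩)
    simp only [Fin.sum_univ_two, Matrix.cons_val_zero, Matrix.cons_val_one, mul_zero,
      add_zero, mul_comm (q η) (p η)] at h
    simp only [Function.comp_apply, hgf _ h1, hgf _ h2, hgf _ h3]
    linarith
  linarith

theorem continuousAt_zero_of_posSemidef (hR : 0 < R) (hl : 2 ≤ l) (hn : 3 ≤ n)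
    (hf : ∀ A ∈ PSDRankLE n l (halfInterval R), (entrywise f A).PosSemidef)
    {g : ℝ → ℝ} (hg : Monotone g) {ρ : ℝ} (hρ : 0 < ρ) (hρR : (ρ : EReal) < R)
    (hgf : ∀ t ∈ Set.Icc 0 ρ, g t = f t) (hg0 : ∀ t ≤ 0, g t = f 0) : ContinuousAt g 0 := by
  have hleft : g.leftLim 0 = f 0 := by
    refine tendsto_nhds_unique (hg.tendsto_leftLim 0) (tendsto_const_nhds.congr' ?_)
    filter_upwards [self_mem_nhdsWithin] with t ht
    exact (hg0 t (le_of_lt ht)).symm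
  rw [hg.continuousAt_iff_leftLim_eq_rightLim]
  refine le_antisymm (hg.leftLim_le_rightLim le_rfl) ?_
  rw [hleft]
  have t2 : Tendsto (fun η : ℝ => 2 * η) (𝓝[>] 0) (𝓝[>] 0) := by
    refine tendsto_nhdsWithin_iff.2 ⟨?_, ?_⟩
    · have : Continuous fun η : ℝ => 2 * η := by fun_prop
      simpa using (this.tendsto 0).mono_left (nhdsWithin_le_nhds (s := Set.Ioi 0))
    · filter_upwards [self_mem_nhdsWithin] with t ht
      have : (0 : ℝ) < t := ht
      exact Set.mem_Ioi.2 (by linarith)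
  have l1 := hg.tendsto_rightLim 0
  have l2 := l1.comp t2
  have key : 0 ≤ 4 * g.rightLim 0 - 6 * g.rightLim 0 + 2 * f 0 := by
    refine ge_of_tendsto (((l2.const_mul 4).sub (l1.const_mul 6)).add_const (2 * f 0)) ?_
    filter_upwards [self_mem_nhdsWithin,
      nhdsWithin_le_nhds (Iio_mem_nhds (half_pos hρ))] with η h1 h2
    have hη0 : 0 < η := h1
    have hηρ : η < ρ / 2 := h2
    have hI : ∀ {t : ℝ}, t ∈ Set.Icc 0 ρ → t ∈ halfInterval R := fun ht =>
      mem_halfInterval_of_le ht.1 ht.2 ⟨hρ.le, hρR⟩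
    have m1 : η ∈ Set.Icc 0 ρ := ⟨hη0.le, by linarith⟩
    have m2 : 2 * η ∈ Set.Icc 0 ρ := ⟨by linarith, by linarith⟩
    have hs : √η * √η = η := Real.mul_self_sqrt hη0.le
    have hs2 : η + η = 2 * η := by ring
    have h := sum_planar_gram_nonneg (zero_mem_halfInterval hR) hl hf hn ![√η, √η, 0]
      ![0, √η, √η] ![1, -2, 1] (by
        intro i j
        fin_cases i <;> fin_cases j <;>
          simp [hs, hs2, hI m1, hI m2, zero_mem_halfInterval hR])
    simp only [Fin.sum_univ_three, Matrix.cons_val_zero, Matrix.cons_val_one,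
      Matrix.cons_val_two, Matrix.tail_cons, Matrix.head_cons, mul_zero,
      zero_mul, add_zero, zero_add, hs, hs2] at h
    simp only [Function.comp_apply, hgf _ m1, hgf _ m2]
    linarith
  linarith

theorem continuousOn_of_posSemidef (hR : 0 < R) (hl : 2 ≤ l) (hn : 3 ≤ n)
    (hf : ∀ A ∈ PSDRankLE n l (halfInterval R), (entrywise f A).PosSemidef) :
    ContinuousOn f (halfInterval R) := by
  intro x hx
  obtain ⟨ρ, hρ, hρR⟩ := EReal.lt_iff_exists_real_btwn.1 hx.2
  have hxρ : x < ρ := EReal.coe_lt_coe_iff.1 hρ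
  have hρ0 : 0 < ρ := hx.1.trans_lt hxρ
  have hI : ∀ {t : ℝ}, 0 ≤ t → t ≤ ρ → t ∈ halfInterval R := fun h h' =>
    mem_halfInterval_of_le h h' ⟨hρ0.le, hρR⟩
  let g : ℝ → ℝ := fun t => f (max 0 (min t ρ))
  have hg : Monotone g := fun s t hst =>
    monotoneOn_of_posSemidef hR hl (by omega) hf
      (hI (le_max_left _ _) (max_le hρ0.le (min_le_right _ _)))
      (hI (le_max_left _ _) (max_le hρ0.le (min_le_right _ _)))
      (max_le_max le_rfl (min_le_min hst le_rfl))
  have hgf : ∀ t ∈ Set.Icc 0 ρ, g t = f t := fun t ht => by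
    simp only [g, min_eq_left ht.2, max_eq_right ht.1]
  have hgx : ContinuousAt g x := by
    rcases hx.1.lt_or_eq with h | rfl
    · exact continuousAt_of_posSemidef hR hl (by omega) hf hg hρR hgf h hxρ
    · refine continuousAt_zero_of_posSemidef hR hl hn hf hg hρ0 hρR hgf fun t ht => ?_
      simp only [g, min_eq_left (ht.trans hρ0.le), max_eq_left ht]
  refine hgx.continuousWithinAt.congr_of_eventuallyEq ?_ (hgf x ⟨hx.1, hxρ.le⟩).symm
  filter_upwards [self_mem_nhdsWithin, nhdsWithin_le_nhds (Iio_mem_nhds hxρ)] with t h1 h2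
  exact (hgf t ⟨h1.1, le_of_lt h2⟩).symm

theorem entrywise_affine {I : Set ℝ} {c₁ : ℝ} (hc : ∀ x ∈ I, f x = f 0 + c₁ * x)
    {A : Matrix (Fin n) (Fin n) ℝ} (hA : ∀ i j, A i j ∈ I) :
    entrywise f A = f 0 • Matrix.vecMulVec (fun _ => 1) (fun _ => 1) + c₁ • A := by
  ext i j
  simp [entrywise, Matrix.vecMulVec_apply, hc _ (hA i j)]

theorem rank_add_le_rank_add_rank (A B : Matrix (Fin n) (Fin n) ℝ) :
    (A + B).rank ≤ A.rank + B.rank := by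
  rw [Matrix.rank, Matrix.mulVecLin_add]
  exact (Submodule.finrank_mono (LinearMap.range_add_le _ _)).trans
    (Submodule.finrank_add_le_finrank_add_finrank _ _)

theorem rank_entrywise_affine_le {I : Set ℝ} {c₁ : ℝ} (hc : ∀ x ∈ I, f x = f 0 + c₁ * x)
    {A : Matrix (Fin n) (Fin n) ℝ} (hA : ∀ i j, A i j ∈ I) (hr : A.rank ≤ l) (hlk : l < k) :
    (entrywise f A).rank ≤ k := by
  rw [entrywise_affine hc hA]
  have h1 := rank_add_le_rank_add_rank (f 0 • Matrix.vecMulVec (fun _ : Fin n => (1 : ℝ)) fun _ => 1)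
    (c₁ • A)
  have h2 := Matrix.rank_vecMulVec_le (fun _ : Fin n => f 0) (fun _ : Fin n => (1 : ℝ))
  have h3 : f 0 • Matrix.vecMulVec (fun _ : Fin n => (1 : ℝ)) (fun _ => 1) =
      Matrix.vecMulVec (fun _ : Fin n => f 0) (fun _ : Fin n => (1 : ℝ)) := by
    ext i j
    simp [Matrix.vecMulVec_apply]
  have h4 : (c₁ • A).rank ≤ A.rank := by
    have : c₁ • A = (c₁ • (1 : Matrix (Fin n) (Fin n) ℝ)) * A := by simp
    rw [this]
    exact Matrix.rank_mul_le_right _ _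
  rw [h3] at h1 ⊢
  omega

theorem isSymm_entrywise {A : Matrix (Fin n) (Fin n) ℝ} (hA : A.IsSymm) :
    (entrywise f A).IsSymm := by
  ext i j
  simp [entrywise, hA.apply i j]

theorem isSymm_of_posSemidef {A : Matrix (Fin n) (Fin n) ℝ} (hA : A.PosSemidef) : A.IsSymm := by
  have h := hA.1
  rwa [Matrix.IsHermitian, Matrix.conjTranspose_eq_transpose_of_trivial] at h

theorem posSemidef_entrywise_affine {I : Set ℝ} {c₁ : ℝ} (hc0 : 0 ≤ f 0) (hc1 : 0 ≤ c₁)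
    (hc : ∀ x ∈ I, f x = f 0 + c₁ * x) {A : Matrix (Fin n) (Fin n) ℝ}
    (hA : ∀ i j, A i j ∈ I) (hpsd : A.PosSemidef) : (entrywise f A).PosSemidef := by
  rw [entrywise_affine hc hA]
  have h := Matrix.posSemidef_vecMulVec_self_star (fun _ : Fin n => (1 : ℝ))
  have e : star (fun _ : Fin n => (1 : ℝ)) = fun _ => 1 := by
    ext
    simp
  rw [e] at h
  exact (h.smul hc0).add (hpsd.smul hc1)

theorem coeff_nonneg_of_posSemidef (hl : 2 ≤ l) (hn : 2 ≤ n) {I : Set ℝ} (h0 : (0 : ℝ) ∈ I)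
    {r : ℝ} (hr : 0 < r) (hrI : r ∈ I)
    (hf : ∀ A ∈ PSDRankLE n l I, (entrywise f A).PosSemidef) {c₁ : ℝ}
    (hc : ∀ x ∈ I, f x = f 0 + c₁ * x) : 0 ≤ f 0 ∧ 0 ≤ c₁ := by
  have hs : √r * √r = r := Real.mul_self_sqrt hr.le
  have h := fun c : Fin 2 → ℝ => sum_planar_gram_nonneg h0 hl hf hn ![√r, 0] ![0, 0] c (by
    simp [Fin.forall_fin_two, hs, h0, hrI])
  simp only [Fin.sum_univ_two, Matrix.cons_val_zero, Matrix.cons_val_one, mul_zero, zero_mul,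
    add_zero, hs, hc r hrI] at h
  have h1 := h ![0, 1]
  have h2 := h ![1, -1]
  simp only [Matrix.cons_val_zero, Matrix.cons_val_one] at h1 h2
  refine ⟨by linarith, ?_⟩
  by_contra! hneg
  nlinarith

theorem posSemidef_preserver_iff (hR : 0 < R) (hl : 2 < l) (hlk : l < k) (hk : k < 2 * l)
    (hn : k + 2 ≤ n) {I : Set ℝ} (hI : I = halfInterval R ∨ I = symmInterval R)
    (hcont : (∀ A ∈ PSDRankLE n l I, entrywise f A ∈ PSDRankLE n k Set.univ) →
      ContinuousOn f I) :
    (∀ A ∈ PSDRankLE n l I, entrywise f A ∈ PSDRankLE n k Set.univ) ↔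
      0 ≤ f 0 ∧ ∃ c₁ : ℝ, 0 ≤ c₁ ∧ ∀ x ∈ I, f x = f 0 + c₁ * x := by
  constructor
  · intro h
    obtain ⟨c₁, hc⟩ := exists_affine_of_rank_le hR hl hk hn hI (hcont h) fun A hA => (h A hA).2.2
    obtain ⟨r, hrI, hr⟩ := exists_pos_mem_halfInterval hR
    have hsub : halfInterval R ⊆ I := by
      rcases hI with rfl | rfl
      exacts [subset_rfl, halfInterval_subset_symmInterval hR]
    obtain ⟨hf0, hc1⟩ := coeff_nonneg_of_posSemidef hl.le (by omega)
      (hsub (zero_mem_halfInterval hR)) hr (hsub hrI) (fun A hA => (h A hA).1) hc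
    exact ⟨hf0, c₁, hc1, hc⟩
  · rintro ⟨hf0, c₁, hc1, hc⟩ A hA
    exact ⟨posSemidef_entrywise_affine hf0 hc1 hc hA.2.1 hA.1, fun _ _ => trivial,
      rank_entrywise_affine_le hc hA.2.1 hA.2.2 hlk⟩

end RankEntrywise

theorem mainTheorem8 (R : EReal) (hR : 0 < R) (n l k : ℕ) (hl : 2 < l) (hlk : l < k)
    (hk : k < min (2 * l) (n - 1)) :
    (∀ (I : Set ℝ) (_ : I = RankEntrywise.halfInterval R ∨ I = RankEntrywise.symmInterval R)
        (f : ℝ → ℝ) (_ : ContinuousOn f I),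
      List.TFAE [
        ∀ A ∈ RankEntrywise.SymmRankLE n l I,
          RankEntrywise.entrywise f A ∈ RankEntrywise.SymmRankLE n k Set.univ,
        ∀ A ∈ RankEntrywise.PSDRankLE n l I,
          RankEntrywise.entrywise f A ∈ RankEntrywise.SymmRankLE n k Set.univ,
        ∃ c₁ : ℝ, ∀ x ∈ I, f x = f 0 + c₁ * x] ∧
      ((∀ A ∈ RankEntrywise.PSDRankLE n l I,
          RankEntrywise.entrywise f A ∈ RankEntrywise.PSDRankLE n k Set.univ) ↔
        0 ≤ f 0 ∧ ∃ c₁ : ℝ, 0 ≤ c₁ ∧ ∀ x ∈ I, f x = f 0 + c₁ * x)) ∧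
    (k + 3 ≤ n → ∀ f : ℝ → ℝ,
      (∀ A ∈ RankEntrywise.PSDRankLE n l (RankEntrywise.halfInterval R),
          RankEntrywise.entrywise f A ∈ RankEntrywise.PSDRankLE n k Set.univ) ↔
        0 ≤ f 0 ∧ ∃ c₁ : ℝ, 0 ≤ c₁ ∧
          ∀ x ∈ RankEntrywise.halfInterval R, f x = f 0 + c₁ * x) := by

  have hk1 : k < 2 * l := hk.trans_le (min_le_left _ _)
  have hn : k + 2 ≤ n := by
    have := hk.trans_le (min_le_right _ _)
    omega
  refine ⟨fun I hI f hcont => ⟨?_, ?_⟩, fun _ f => ?_⟩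
  · tfae_have 1 → 2 := fun h A hA =>
      h A ⟨RankEntrywise.isSymm_of_posSemidef hA.1, hA.2⟩
    tfae_have 2 → 3 := fun h =>
      RankEntrywise.exists_affine_of_rank_le hR hl hk1 hn hI hcont fun A hA => (h A hA).2.2
    tfae_have 3 → 1 := by
      rintro ⟨c₁, hc⟩ A hA
      exact ⟨RankEntrywise.isSymm_entrywise hA.1, fun _ _ => trivial,
        RankEntrywise.rank_entrywise_affine_le hc hA.2.1 hA.2.2 hlk⟩
    tfae_finish
  · exact RankEntrywise.posSemidef_preserver_iff hR hl hlk hk1 hn hI fun _ => hcont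
  · exact RankEntrywise.posSemidef_preserver_iff hR hl hlk hk1 hn (Or.inl rfl) fun h =>
      RankEntrywise.continuousOn_of_posSemidef hR hl.le (by omega) fun A hA => (h A hA).1
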